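/- Call a compact metric space $Y$ an *IFS-attractor* if $Y=\bigcup_{i=1}^n f_i(Y)$ for some finitely many maps $f_1,\dots,f_n:Y\to Y$ that are contractions (Lipschitz with constant $<1$). Call a compact topological space $X$ a *topological IFS-attractor* if $X=\bigcup_{i=1}^n f_i(X)$ for some finitely many continuous maps $f_1,\dots,f_n:X\to X$ such that for every open cover $\mathcal U$ of $X$ there is $m\in\mathbb N$ such that for all $g_1,\dots,g_m\in\{f_1,\dots,f_n\}$ the set $g_1\circ\dots\circ g_m(X)$ lies in some $U\in\mathcal U$. Let $\varphi(t)$ be the distance from $t\in\mathbb R$ to the nearest integer, let $\varphi_n(t)=2^{-n}\varphi(2^n t)$, let $n_k=\lfloor\log_2\log_2(k+1)\rfloor$ for $k\ge 1$, and let $$M=\big([0,1]\times\{0\}\big)\cup\bigcup_{k=1}^\infty\Big\{\big(t,\tfrac1k\varphi_{n_k}(t)\big):t\in[0,1]\Big\}\subset\mathbb R^2$$ be the corresponding shark teeth space. Then $M$ is compact, $M$ (with the subspace topology) is a topological IFS-attractor, and $M$ is not homeomorphic to any IFS-attractor. In particular, there exists a compact metric space that is a topological IFS-attractor but is not homeomorphic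 to any IFS-attractor. -/

import Mathlib

/-- A (compact) metric space `X` is an IFS-attractor if it is the union of the images of finitely
many contractions `f₁, …, fₙ : X → X` (maps with Lipschitz constant `< 1`). -/
def IsIFSAttractor (X : Type*) [MetricSpace X] : Prop :=
  CompactSpace X ∧ ∃ (n : ℕ) (f : Fin n → X → X),
    (∀ i, ∃ K : NNReal, ContractingWith K (f i)) ∧
    (⋃ i, Set.range (f i)) = Set.univ

/-- The composition `g₁ ∘ ⋯ ∘ gₘ` of the maps `gⱼ = f (w j)`; the identity if `m = 0`. -/
def wordComp {X : Type*} {n m : ℕ} (f : Fin n → X → X) (w : Fin m → Fin n) : X → X :=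
  (List.ofFn fun j => f (w j)).foldr (fun g h => g ∘ h) id

/-- A (compact) topological space `X` is a topological IFS-attractor if it is the union of the
images of finitely many continuous maps `f₁, …, fₙ : X → X` such that for every open cover `𝒰`
of `X` there is an `m` for which the image of `X` under any composition of `m` of these maps
lies in some member of `𝒰`. -/
def IsTopologicalIFSAttractor (X : Type*) [TopologicalSpace X] : Prop :=
  CompactSpace X ∧ ∃ (n : ℕ) (f : Fin n → X → X),
    (∀ i, Continuous (f i)) ∧
    (⋃ i, Set.range (f i)) = Set.univ ∧
    ∀ 𝒰 : Set (Set X), (∀ U ∈ 𝒰, IsOpen U) → ⋃₀ 𝒰 = Set.univ →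
      ∃ m : ℕ, ∀ w : Fin m → Fin n, ∃ U ∈ 𝒰, Set.range (wordComp f w) ⊆ U

/-- The zigzag function `φ`: the distance from `t` to the nearest integer. -/
noncomputable def zigzag (t : ℝ) : ℝ := |t - round t|

/-- On `[n, n + 1/2]` the zigzag function is `t - n`. -/
theorem zigzag_of_mem_right (t : ℝ) (n : ℤ) (h₁ : n ≤ t) (h₂ : t ≤ n + 1 / 2) :
    zigzag t = t - n := by
  unfold zigzag
  have h := Int.fract_add_floor t
  rw [abs_sub_round_eq_min]
  have hf : ⌊t⌋ = n := Int.floor_eq_iff.2 ⟨h₁, by linarith⟩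
  rw [hf] at h
  rw [min_eq_left (by linarith)]
  linarith

/-- On `[n - 1/2, n]` the zigzag function is `n - t`. -/
theorem zigzag_of_mem_left (t : ℝ) (n : ℤ) (h₁ : n - 1 / 2 ≤ t) (h₂ : t ≤ n) :
    zigzag t = n - t := by
  rcases h₂.eq_or_lt with rfl | h₂
  · simp [zigzag]
  unfold zigzag
  have h := Int.fract_add_floor t
  rw [abs_sub_round_eq_min]
  have hf : ⌊t⌋ = n - 1 := Int.floor_eq_iff.2 ⟨by push_cast; linarith, by push_cast; linarith⟩
  rw [hf] at h
  push_cast at h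
  rw [min_eq_right (by linarith)]
  linarith

/-- `φₙ(t) = 2⁻ⁿ φ(2ⁿ t)`. -/
noncomputable def zigzagScaled (n : ℕ) (t : ℝ) : ℝ := (2 ^ n)⁻¹ * zigzag (2 ^ n * t)

/-- The bone `I = [0,1] × {0}`. -/
def bone : Set (ℝ × ℝ) := Set.Icc 0 1 ×ˢ {0}

/-- The `k`-th row of teeth `M_k = {(t, φ_{n_k}(t) / k) : t ∈ [0,1]}`, used for `k ≥ 1` only. -/
def teethRow (n : ℕ → ℕ) (k : ℕ) : Set (ℝ × ℝ) :=
  {p | ∃ t ∈ Set.Icc (0 : ℝ) 1, p = (t, 1 / (k : ℝ) * zigzagScaled (n k) t)}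

/-- The shark teeth with parameters `n₁, n₂, …`. -/
def sharkTeeth (n : ℕ → ℕ) : Set (ℝ × ℝ) := bone ∪ ⋃ k : ℕ, ⋃ _ : 1 ≤ k, teethRow n k

/-- The sequence `n_k = ⌊log₂ log₂ (k + 1)⌋`, used for `k ≥ 1` only, where
`log₂ log₂ (k + 1) ≥ 0`. -/
noncomputable def loglogSeq (k : ℕ) : ℕ := ⌊Real.logb 2 (Real.logb 2 ((k : ℝ) + 1))⌋₊

/-! Positive half: five maps `c i ∘ ψ` through the unit interval suffice. Here `ψ = firstRowMap`
vanishes off the first row, `c 0 = laterRowsPath` is a path filling everything else, and the other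
`c i` trace quarters of the first row. Each `ψ ∘ c i` is `1/2`-Lipschitz, so long compositions have
small image under `ψ`, and uniform continuity of the `c i` does the rest
(`isTopologicalIFSAttractor_of_factor_unitInterval`). The filling path exists because teeth over a
short dyadic interval are also low: detours along finitely many teeth per level converge uniformly,
and the bone appears as the limit of the rows.

Negative half: count teeth. An attractor metric would cover the connected space by `N ^ m` connected
sets of diameter at most `K ^ m * D` (`exists_preconnected_cover`). Some dyadic interval of length
`2⁻ⁿ` on the bone has endpoints at distance at least `Δ / 2ⁿ` (`exists_dyadic_dist_ge`), and each
level `n` tooth above it has a point at least half that far from both of its ends. A smaller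
connected set through this point is trapped in its tooth (`preconnected_subset_openTooth`), so the
at least `2 ^ 2 ^ n` teeth need different pieces. But `m` linear in `n` already makes the pieces
small enough, and then `N ^ m` is only exponential in `n` (`exists_pow_mul_lt_and_pow_lt`). -/

/-! ### Zigzag functions. -/

theorem zigzag_le_abs_sub (t : ℝ) (z : ℤ) : zigzag t ≤ |t - z| := round_le t z

theorem zigzag_nonneg (t : ℝ) : 0 ≤ zigzag t := abs_nonneg _

theorem zigzag_le_half (t : ℝ) : zigzag t ≤ 1 / 2 := abs_sub_round t

theorem zigzag_sub_le (s t : ℝ) : zigzag s - zigzag t ≤ |s - t| := by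
  have h := zigzag_le_abs_sub s (round t)
  have h2 := abs_sub_le s t (round t)
  have : zigzag t = |t - round t| := rfl
  linarith

theorem abs_zigzag_sub_le (s t : ℝ) : |zigzag s - zigzag t| ≤ |s - t| := by
  rw [abs_le]
  have h1 := zigzag_sub_le s t
  have h2 := zigzag_sub_le t s
  rw [abs_sub_comm t s] at h2
  constructor <;> linarith

theorem continuous_zigzag : Continuous zigzag :=
  (LipschitzWith.of_dist_le_mul (K := 1) fun s t => by
    simpa [Real.dist_eq] using abs_zigzag_sub_le s t).continuous

theorem zigzagScaled_nonneg (n : ℕ) (t : ℝ) : 0 ≤ zigzagScaled n t :=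
  mul_nonneg (by positivity) (zigzag_nonneg _)

theorem zigzagScaled_le (n : ℕ) (t : ℝ) : zigzagScaled n t ≤ (2 ^ n)⁻¹ := by
  have h := zigzag_le_half (2 ^ n * t)
  have h2 : (0 : ℝ) < (2 ^ n)⁻¹ := by positivity
  unfold zigzagScaled
  nlinarith

theorem continuous_zigzagScaled (n : ℕ) : Continuous (zigzagScaled n) := by
  unfold zigzagScaled
  exact continuous_const.mul (continuous_zigzag.comp (continuous_const.mul continuous_id))

theorem zigzagScaled_zero (t : ℝ) : zigzagScaled 0 t = zigzag t := by simp [zigzagScaled]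

/-- Twice the integer nearest to `2 ^ n * t` competes for being nearest to `2 ^ (n + 1) * t`. With
monotonicity of the levels, this keeps later rows below earlier ones. -/
theorem zigzagScaled_antitone (t : ℝ) : Antitone fun n => zigzagScaled n t := by
  refine antitone_nat_of_succ_le fun n => ?_
  have h := zigzag_le_abs_sub (2 ^ (n + 1) * t) (2 * round (2 ^ n * t))
  have e : (2 : ℝ) ^ (n + 1) * t - ((2 * round (2 ^ n * t) : ℤ) : ℝ)
      = 2 * (2 ^ n * t - round (2 ^ n * t)) := by push_cast; ring
  rw [e, abs_mul, abs_of_pos (two_pos : (0 : ℝ) < 2)] at h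
  calc zigzagScaled (n + 1) t ≤ (2 ^ (n + 1))⁻¹ * (2 * |2 ^ n * t - round (2 ^ n * t)|) :=
        mul_le_mul_of_nonneg_left h (by positivity)
    _ = zigzagScaled n t := by
        unfold zigzagScaled zigzag
        rw [pow_succ]
        field_simp

theorem zigzagScaled_div (n j : ℕ) : zigzagScaled n (j / 2 ^ n) = 0 := by
  have : (2 : ℝ) ^ n * (j / 2 ^ n) = j := by field_simp
  simp [zigzagScaled, this, zigzag]

theorem zigzagScaled_pos {n j : ℕ} {t : ℝ} (h₁ : (j : ℝ) / 2 ^ n < t)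
    (h₂ : t < ((j + 1 : ℕ) : ℝ) / 2 ^ n) : 0 < zigzagScaled n t := by
  have h2n : (0 : ℝ) < 2 ^ n := by positivity
  rw [div_lt_iff₀ h2n, mul_comm] at h₁
  rw [lt_div_iff₀ h2n, mul_comm] at h₂
  refine mul_pos (by positivity) (abs_pos.2 fun h => ?_)
  rw [sub_eq_zero.1 h] at h₁ h₂
  have h₁' : (j : ℤ) < round (2 ^ n * t) := by exact_mod_cast h₁
  have h₂' : round (2 ^ n * t) < (j : ℤ) + 1 := by exact_mod_cast h₂
  omega

/-! ### Compactness and connectedness of shark teeth. -/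

theorem mem_sharkTeeth {n : ℕ → ℕ} {p : ℝ × ℝ} :
    p ∈ sharkTeeth n ↔ p.1 ∈ Set.Icc (0 : ℝ) 1 ∧
      (p.2 = 0 ∨ ∃ k : ℕ, 1 ≤ k ∧ p.2 = 1 / (k : ℝ) * zigzagScaled (n k) p.1) := by
  obtain ⟨t, y⟩ := p
  simp only [sharkTeeth, bone, teethRow, Set.mem_union, Set.mem_prod, Set.mem_singleton_iff,
    Set.mem_iUnion, Set.mem_ofPred_eq, Prod.mk.injEq, exists_prop]
  constructor
  · rintro (⟨h1, h2⟩ | ⟨k, hk, s, hs, rfl, h⟩)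
    · exact ⟨h1, Or.inl h2⟩
    · exact ⟨hs, Or.inr ⟨k, hk, h⟩⟩
  · rintro ⟨h1, h2 | ⟨k, hk, h⟩⟩
    · exact Or.inl ⟨h1, h2⟩
    · exact Or.inr ⟨k, hk, t, h1, rfl, h⟩

theorem bone_mem_sharkTeeth (n : ℕ → ℕ) {t : ℝ} (ht : t ∈ Set.Icc (0 : ℝ) 1) :
    (t, (0 : ℝ)) ∈ sharkTeeth n :=
  mem_sharkTeeth.2 ⟨ht, Or.inl rfl⟩

theorem row_mem_sharkTeeth (n : ℕ → ℕ) {k : ℕ} (hk : 1 ≤ k) {t : ℝ} (ht : t ∈ Set.Icc (0 : ℝ) 1) :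
    (t, 1 / (k : ℝ) * zigzagScaled (n k) t) ∈ sharkTeeth n :=
  mem_sharkTeeth.2 ⟨ht, Or.inr ⟨k, hk, rfl⟩⟩

theorem row_height_le (n k : ℕ) (t : ℝ) :
    1 / (k : ℝ) * zigzagScaled n t ≤ zigzagScaled n t := by
  have h0 := zigzagScaled_nonneg n t
  rcases Nat.eq_zero_or_pos k with rfl | hk
  · simpa using h0
  · refine mul_le_of_le_one_left h0 ?_
    rw [div_le_one (by positivity)]
    exact_mod_cast hk

theorem teethRow_eq_image (n : ℕ → ℕ) (k : ℕ) :
    teethRow n k = (fun t : ℝ => (t, 1 / (k : ℝ) * zigzagScaled (n k) t)) '' Set.Icc 0 1 := by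
  ext p
  simp only [teethRow, Set.mem_ofPred_eq, Set.mem_image, eq_comm]

theorem isCompact_teethRow (n : ℕ → ℕ) (k : ℕ) : IsCompact (teethRow n k) := by
  rw [teethRow_eq_image]
  exact isCompact_Icc.image
    (continuous_id.prodMk (continuous_const.mul (continuous_zigzagScaled _)))

/-- All rows beyond `K` fit in a strip that shrinks to the bone, so the infinite union becomes an
intersection of closed sets. -/
theorem sharkTeeth_eq_iInter (n : ℕ → ℕ) :
    sharkTeeth n = ⋂ K : ℕ, (Set.Icc (0 : ℝ) 1 ×ˢ Set.Icc (0 : ℝ) (1 / ((K : ℝ) + 1)) ∪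
      ⋃ k ∈ Finset.Icc 1 K, teethRow n k) := by
  ext ⟨t, y⟩
  rw [Set.mem_iInter]
  constructor
  · intro h K
    obtain ⟨ht, hy⟩ := mem_sharkTeeth.1 h
    simp only at ht hy
    obtain rfl | ⟨k, hk, rfl⟩ := hy
    · exact Or.inl ⟨ht, le_rfl, by positivity⟩
    · by_cases hK : k ≤ K
      · refine Or.inr (Set.mem_iUnion₂.2 ⟨k, Finset.mem_Icc.2 ⟨hk, hK⟩, t, ht, rfl⟩)
      · have h0 := zigzagScaled_nonneg (n k) t
        refine Or.inl ⟨ht, mul_nonneg (by positivity) h0, ?_⟩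
        have h1 : zigzagScaled (n k) t ≤ 1 := (zigzagScaled_le _ _).trans
          (inv_le_one_of_one_le₀ (one_le_pow₀ (by norm_num)))
        have h2 : (K : ℝ) + 1 ≤ k := by exact_mod_cast not_le.1 hK
        calc 1 / (k : ℝ) * zigzagScaled (n k) t ≤ 1 / (k : ℝ) :=
              mul_le_of_le_one_right (by positivity) h1
          _ ≤ _ := one_div_le_one_div_of_le (by positivity) h2
  · intro h
    have hrow : ∀ K, (t, y) ∈ ⋃ k ∈ Finset.Icc 1 K, teethRow n k → (t, y) ∈ sharkTeeth n := by
      intro K hK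
      obtain ⟨k, hk, hm⟩ := Set.mem_iUnion₂.1 hK
      exact Or.inr (Set.mem_iUnion₂.2 ⟨k, (Finset.mem_Icc.1 hk).1, hm⟩)
    rcases h 0 with h0 | h0
    · rcases h0.2.1.eq_or_lt with hy | hy
      · exact mem_sharkTeeth.2 ⟨h0.1, Or.inl hy.symm⟩
      · obtain ⟨K, hK⟩ := exists_nat_one_div_lt hy
        rcases h K with h1 | h1
        · exact absurd h1.2.2 (not_le.2 hK)
        · exact hrow K h1
    · exact hrow 0 h0

theorem isCompact_sharkTeeth (n : ℕ → ℕ) : IsCompact (sharkTeeth n) := by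
  have hc : IsClosed (sharkTeeth n) := by
    rw [sharkTeeth_eq_iInter]
    refine isClosed_iInter fun K => (isClosed_Icc.prod isClosed_Icc).union ?_
    exact isClosed_biUnion_finset fun k _ => (isCompact_teethRow n k).isClosed
  refine (isCompact_Icc.prod isCompact_Icc :
    IsCompact (Set.Icc (0 : ℝ) 1 ×ˢ Set.Icc (0 : ℝ) 1)).of_isClosed_subset hc ?_
  rw [sharkTeeth_eq_iInter]
  refine (Set.iInter_subset _ 0).trans ?_
  simp

theorem isPreconnected_sharkTeeth (n : ℕ → ℕ) : IsPreconnected (sharkTeeth n) := by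
  have hb : IsPreconnected bone := isPreconnected_Icc.prod isPreconnected_singleton
  have hr : ∀ k, IsPreconnected (teethRow n k) := by
    intro k
    rw [teethRow_eq_image]
    exact isPreconnected_Icc.image _
      (continuous_id.prodMk (continuous_const.mul (continuous_zigzagScaled _))).continuousOn
  have h0 : ∀ k, ((0 : ℝ), (0 : ℝ)) ∈ teethRow n k := fun k =>
    ⟨0, by simp, by simp [zigzagScaled, zigzag]⟩
  have hU : IsPreconnected (⋃ k : ℕ, ⋃ _ : 1 ≤ k, teethRow n k) := by
    have : (⋃ k : ℕ, ⋃ _ : 1 ≤ k, teethRow n k) = ⋃ k : {k : ℕ // 1 ≤ k}, teethRow n k := by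
      ext; simp
    rw [this]
    exact isPreconnected_iUnion ⟨_, Set.mem_iInter.2 fun k => h0 k⟩ fun k => hr k
  exact hb.union (0, 0) ⟨by simp, rfl⟩ (Set.mem_iUnion₂.2 ⟨1, le_rfl, h0 1⟩) hU

/-! ### Levels of the rows. -/

theorem loglogSeq_eq {k n : ℕ} (h₁ : 2 ^ 2 ^ n ≤ k + 1) (h₂ : k + 1 < 2 ^ 2 ^ (n + 1)) :
    loglogSeq k = n := by
  have h₁' : (2 : ℝ) ^ 2 ^ n ≤ (k : ℝ) + 1 := by exact_mod_cast h₁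
  have h₂' : (k : ℝ) + 1 < (2 : ℝ) ^ 2 ^ (n + 1) := by exact_mod_cast h₂
  have hk : (0 : ℝ) < (k : ℝ) + 1 := by positivity
  have a₁ : (2 : ℝ) ^ n ≤ Real.logb 2 ((k : ℝ) + 1) := by
    rw [Real.le_logb_iff_rpow_le one_lt_two hk]
    exact_mod_cast h₁'
  have a₂ : Real.logb 2 ((k : ℝ) + 1) < (2 : ℝ) ^ (n + 1) := by
    rw [Real.logb_lt_iff_lt_rpow one_lt_two hk]
    exact_mod_cast h₂'
  have hl : 0 < Real.logb 2 ((k : ℝ) + 1) := lt_of_lt_of_le (by positivity) a₁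
  have b₁ : (n : ℝ) ≤ Real.logb 2 (Real.logb 2 ((k : ℝ) + 1)) := by
    rw [Real.le_logb_iff_rpow_le one_lt_two hl]
    exact_mod_cast a₁
  have b₂ : Real.logb 2 (Real.logb 2 ((k : ℝ) + 1)) < (n : ℝ) + 1 := by
    rw [Real.logb_lt_iff_lt_rpow one_lt_two hl]
    exact_mod_cast a₂
  exact (Nat.floor_eq_iff (le_trans (by positivity) b₁)).2 ⟨b₁, b₂⟩

theorem loglogSeq_mono {k l : ℕ} (hk : 1 ≤ k) (hkl : k ≤ l) : loglogSeq k ≤ loglogSeq l := by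
  have hk' : (1 : ℝ) ≤ k := by exact_mod_cast hk
  have hkl' : (k : ℝ) ≤ l := by exact_mod_cast hkl
  have h1 : 0 < Real.logb 2 ((k : ℝ) + 1) := Real.logb_pos one_lt_two (by linarith)
  refine Nat.floor_mono (Real.logb_le_logb_of_le one_lt_two h1 ?_)
  exact Real.logb_le_logb_of_le one_lt_two (by linarith) (by linarith)

/-- Each level has finitely many rows; this bound is the cutoff used in `approxPath`. -/
theorem lt_of_loglogSeq_eq {k n : ℕ} (h : loglogSeq k = n) :
    k < 2 ^ 2 ^ (n + 1) := by
  by_contra! hlt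
  have hpos : 1 ≤ 2 ^ 2 ^ (n + 1) := Nat.one_le_two_pow
  have h1 : loglogSeq (2 ^ 2 ^ (n + 1) - 1) = n + 1 := by
    refine loglogSeq_eq (by omega) ?_
    rw [Nat.sub_add_cancel hpos]
    exact Nat.pow_lt_pow_right one_lt_two (Nat.pow_lt_pow_right one_lt_two (by omega))
  have h2 : 1 < 2 ^ 2 ^ (n + 1) := Nat.one_lt_two_pow (by positivity)
  have := loglogSeq_mono (k := 2 ^ 2 ^ (n + 1) - 1) (l := k) (by omega) (by omega)
  omega

/-! ### A criterion for topological IFS-attractors. -/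

open Filter Topology unitInterval in
/-- Maps that factor through the unit interval, and contract it when composed in the other order,
make a compact space a topological IFS-attractor. -/
theorem isTopologicalIFSAttractor_of_factor_unitInterval {X : Type*} [TopologicalSpace X]
    [CompactSpace X] [Nonempty X] {n : ℕ} (c : Fin n → C(I, X)) (ψ : C(X, I))
    (hcov : ∀ x, ∃ i y, c i (ψ y) = x)
    (hlip : ∀ i s t, dist (ψ (c i s)) (ψ (c i t)) ≤ 1 / 2 * dist s t) :
    IsTopologicalIFSAttractor X := by
  refine ⟨inferInstance, n, fun i => c i ∘ ψ, fun i => (c i).continuous.comp ψ.continuous, ?_, ?_⟩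
  · refine Set.eq_univ_of_forall fun x => ?_
    obtain ⟨i, y, h⟩ := hcov x
    exact Set.mem_iUnion.2 ⟨i, y, h⟩
  have hdiam : ∀ (m : ℕ) (w : Fin m → Fin n) (x y : X),
      dist (ψ (wordComp (fun i => c i ∘ ψ) w x)) (ψ (wordComp (fun i => c i ∘ ψ) w y))
        ≤ (1 / 2) ^ m := by
    intro m
    induction m with
    | zero =>
      intro w x y
      rw [pow_zero]
      exact Real.dist_le_of_mem_Icc_01 (ψ _).2 (ψ _).2
    | succ m ih =>
      intro w x y
      have e : wordComp (fun i => c i ∘ ψ) w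
          = (c (w 0) ∘ ψ) ∘ wordComp (fun i => c i ∘ ψ) (Fin.tail w) := by
        simp [wordComp, List.ofFn_succ, Fin.tail]
      rw [e, pow_succ']
      exact (hlip _ _ _).trans (mul_le_mul_of_nonneg_left (ih _ _ _) (by norm_num))
  intro 𝒰 ho hU
  have hleb : ∀ i, ∃ δ > 0, ∀ s : I, ∃ U ∈ 𝒰, Metric.ball s δ ⊆ c i ⁻¹' U := by
    intro i
    obtain ⟨δ, hδ, h⟩ := lebesgue_number_lemma_of_metric (s := (Set.univ : Set I))
      (c := fun U : 𝒰 => c i ⁻¹' U) isCompact_univ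
      (fun U => (ho U U.2).preimage (c i).continuous) (fun s _ => by
        have : c i s ∈ ⋃₀ 𝒰 := hU ▸ Set.mem_univ _
        obtain ⟨U, hUm, hs⟩ := this
        exact Set.mem_iUnion.2 ⟨⟨U, hUm⟩, hs⟩)
    refine ⟨δ, hδ, fun s => ?_⟩
    obtain ⟨U, hs⟩ := h s trivial
    exact ⟨U, U.2, hs⟩
  choose δ hδ hball using hleb
  have hm : ∀ᶠ m : ℕ in atTop, ∀ i, (1 / 2 : ℝ) ^ m < δ i :=
    eventually_all.2 fun i => (tendsto_pow_atTop_nhds_zero_of_lt_one (by norm_num)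
      (by norm_num)).eventually_lt_const (hδ i)
  obtain ⟨m, hm⟩ := hm.exists
  obtain ⟨x₀⟩ := ‹Nonempty X›
  -- The last `m` letters make the image under `ψ` smaller than a Lebesgue number; the extra letter
  -- applies `c (w 0)`, which is merely uniformly continuous.
  refine ⟨m + 1, fun w => ?_⟩
  obtain ⟨U, hUm, hs⟩ := hball (w 0) (ψ (wordComp (fun i => c i ∘ ψ) (Fin.tail w) x₀))
  refine ⟨U, hUm, ?_⟩
  rintro _ ⟨x, rfl⟩
  have e : wordComp (fun i => c i ∘ ψ) w
      = (c (w 0) ∘ ψ) ∘ wordComp (fun i => c i ∘ ψ) (Fin.tail w) := by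
    simp [wordComp, List.ofFn_succ, Fin.tail]
  rw [e]
  exact hs ((hdiam m (Fin.tail w) x x₀).trans_lt (hm _))

/-! ### A path filling all rows but the first. -/

/-- The back-and-forth path along the tooth of the `k`-th row over `[j / 2ⁿ, (j + 1) / 2ⁿ]`. -/
noncomputable def toothLoop (n j k : ℕ) (s : ℝ) : ℝ × ℝ :=
  ((j + 2 * zigzag s) / 2 ^ n, 1 / (k : ℝ) * zigzagScaled n ((j + 2 * zigzag s) / 2 ^ n))

open Classical in
/-- A loop at `j / 2ⁿ` running along all teeth over `[j / 2ⁿ, (j + 1) / 2ⁿ]` from the rows `k` of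
level `n` with `2 ≤ k < K`. -/
noncomputable def teethLoop (n j : ℕ) : ℕ → ℝ → ℝ × ℝ
  | 0, _ => ((j : ℝ) / 2 ^ n, 0)
  | K + 1, s =>
    if s ≤ 1 / 2 then
      (if loglogSeq K = n ∧ 2 ≤ K then toothLoop n j K (2 * s) else ((j : ℝ) / 2 ^ n, 0))
    else teethLoop n j K (2 * s - 1)

/-- A path from `j / 2ⁿ` to `(j + 1) / 2ⁿ` along all teeth of levels `n, …, n + N - 1`, except
those of the first row. -/
noncomputable def approxPath : ℕ → ℕ → ℕ → ℝ → ℝ × ℝ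
  | 0, n, j, s => ((j + s) / 2 ^ n, 0)
  | N + 1, n, j, s =>
    if s ≤ 1 / 2 then teethLoop n j (2 ^ 2 ^ (n + 1)) (2 * s)
    else if s ≤ 3 / 4 then approxPath N (n + 1) (2 * j) (4 * s - 2)
    else approxPath N (n + 1) (2 * j + 1) (4 * s - 3)

theorem zigzag_zero : zigzag 0 = 0 := by simp [zigzag]

theorem zigzag_one : zigzag 1 = 0 := by simp [zigzag]

theorem toothLoop_of_zigzag_eq_zero (n j k : ℕ) {s : ℝ} (hs : zigzag s = 0) :
    toothLoop n j k s = ((j : ℝ) / 2 ^ n, 0) := by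
  simp [toothLoop, hs, zigzagScaled_div]

theorem continuous_toothLoop (n j k : ℕ) : Continuous (toothLoop n j k) := by
  have h : Continuous fun s => ((j : ℝ) + 2 * zigzag s) / 2 ^ n :=
    (continuous_const.add (continuous_const.mul continuous_zigzag)).div_const _
  exact h.prodMk (continuous_const.mul ((continuous_zigzagScaled n).comp h))

theorem teethLoop_zero_one (n j K : ℕ) :
    teethLoop n j K 0 = ((j : ℝ) / 2 ^ n, 0) ∧ teethLoop n j K 1 = ((j : ℝ) / 2 ^ n, 0) := by
  induction K with
  | zero => exact ⟨rfl, rfl⟩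
  | succ K ih =>
    constructor
    · rw [teethLoop, if_pos (by norm_num)]
      split_ifs
      · rw [mul_zero, toothLoop_of_zigzag_eq_zero _ _ _ zigzag_zero]
      · rfl
    · rw [teethLoop, if_neg (by norm_num)]
      norm_num
      exact ih.2

theorem continuous_teethLoop (n j K : ℕ) : Continuous (teethLoop n j K) := by
  induction K with
  | zero => exact continuous_const
  | succ K ih =>
    have e : teethLoop n j (K + 1) = fun s => if s ≤ 1 / 2 then
      (if loglogSeq K = n ∧ 2 ≤ K then toothLoop n j K (2 * s) else ((j : ℝ) / 2 ^ n, 0))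
      else teethLoop n j K (2 * s - 1) := by
      funext s; rw [teethLoop]
    rw [e]
    refine Continuous.if_le ?_ (ih.comp (by fun_prop)) continuous_id continuous_const ?_
    · split_ifs
      · exact (continuous_toothLoop n j K).comp (by fun_prop)
      · exact continuous_const
    · rintro s rfl
      norm_num
      rw [(teethLoop_zero_one n j K).1, toothLoop_of_zigzag_eq_zero _ _ _ zigzag_one]
      simp

theorem approxPath_zero_one (N n j : ℕ) :
    approxPath N n j 0 = ((j : ℝ) / 2 ^ n, 0) ∧
      approxPath N n j 1 = (((j : ℝ) + 1) / 2 ^ n, 0) := by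
  induction N generalizing n j with
  | zero => simp [approxPath]
  | succ N ih =>
    constructor
    · rw [approxPath, if_pos (by norm_num), mul_zero]
      exact (teethLoop_zero_one _ _ _).1
    · rw [approxPath, if_neg (by norm_num), if_neg (by norm_num)]
      have h : (4 : ℝ) * 1 - 3 = 1 := by norm_num
      rw [h, (ih _ _).2, pow_succ]
      push_cast
      congr 1
      field_simp
      ring

theorem two_mul_dyadic (n j : ℕ) : ((2 * j : ℕ) : ℝ) / 2 ^ (n + 1) = (j : ℝ) / 2 ^ n := by
  rw [pow_succ]; push_cast; field_simp

theorem continuous_approxPath (N n j : ℕ) : Continuous (approxPath N n j) := by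
  induction N generalizing n j with
  | zero =>
    simp only [approxPath]
    fun_prop
  | succ N ih =>
    have e : approxPath (N + 1) n j = fun s => if s ≤ 1 / 2 then
        teethLoop n j (2 ^ 2 ^ (n + 1)) (2 * s)
        else if s ≤ 3 / 4 then approxPath N (n + 1) (2 * j) (4 * s - 2)
        else approxPath N (n + 1) (2 * j + 1) (4 * s - 3) := by
      funext s; rw [approxPath]
    rw [e]
    refine Continuous.if_le ((continuous_teethLoop _ _ _).comp (by fun_prop)) ?_
      continuous_id continuous_const ?_
    · refine Continuous.if_le ((ih _ _).comp (by fun_prop)) ((ih _ _).comp (by fun_prop))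
        continuous_id continuous_const ?_
      rintro s rfl
      have h1 : (4 : ℝ) * (3 / 4) - 2 = 1 := by norm_num
      have h2 : (4 : ℝ) * (3 / 4) - 3 = 0 := by norm_num
      rw [h1, h2, (approxPath_zero_one _ _ _).1, (approxPath_zero_one _ _ _).2]
      push_cast
      rfl
    · rintro s rfl
      have h1 : (2 : ℝ) * (1 / 2) = 1 := by norm_num
      have h2 : (4 : ℝ) * (1 / 2) - 2 = 0 := by norm_num
      rw [if_pos (by norm_num), h1, h2, (teethLoop_zero_one _ _ _).2,
        (approxPath_zero_one _ _ _).1, two_mul_dyadic]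

/-- The part of the shark teeth without the interior of the first row. -/
def laterTeeth : Set (ℝ × ℝ) := {p ∈ sharkTeeth loglogSeq | 4 * p.2 ≤ 2 * zigzag p.1}

theorem isClosed_laterTeeth : IsClosed laterTeeth :=
  (isCompact_sharkTeeth _).isClosed.inter
    (isClosed_le (continuous_const.mul continuous_snd)
      (continuous_const.mul (continuous_zigzag.comp continuous_fst)))

theorem bone_mem_laterTeeth {t : ℝ} (ht : t ∈ Set.Icc (0 : ℝ) 1) : (t, (0 : ℝ)) ∈ laterTeeth := by
  refine ⟨bone_mem_sharkTeeth _ ht, ?_⟩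
  have := zigzag_nonneg t
  simpa using this

/-- The factor `1 / k ≤ 1 / 2` puts the row at or below half the height of the first row. -/
theorem row_mem_laterTeeth {k : ℕ} (hk : 2 ≤ k) {t : ℝ} (ht : t ∈ Set.Icc (0 : ℝ) 1) :
    (t, 1 / (k : ℝ) * zigzagScaled (loglogSeq k) t) ∈ laterTeeth := by
  refine ⟨row_mem_sharkTeeth _ (by omega) ht, ?_⟩
  have h1 := zigzagScaled_antitone t (Nat.zero_le (loglogSeq k))
  simp only [zigzagScaled_zero] at h1
  have h0 := zigzagScaled_nonneg (loglogSeq k) t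
  have hk' : (2 : ℝ) ≤ k := by exact_mod_cast hk
  have h2 : 1 / (k : ℝ) ≤ 1 / 2 := one_div_le_one_div_of_le two_pos hk'
  simp only
  nlinarith

theorem two_mul_zigzag_mem (s : ℝ) : 2 * zigzag s ∈ Set.Icc (0 : ℝ) 1 :=
  ⟨by linarith [zigzag_nonneg s], by linarith [zigzag_le_half s]⟩

theorem dyadic_mem {n j : ℕ} (hj : j < 2 ^ n) {s : ℝ} (hs : s ∈ Set.Icc (0 : ℝ) 1) :
    ((j : ℝ) + s) / 2 ^ n ∈ Set.Icc (0 : ℝ) 1 := by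
  have h1 : (j : ℝ) + 1 ≤ 2 ^ n := by exact_mod_cast hj
  have := hs.1
  refine ⟨by positivity, ?_⟩
  rw [div_le_one (by positivity)]
  linarith [hs.2]

theorem dist_dyadic_le {n j : ℕ} {s y : ℝ} (hs : s ∈ Set.Icc (0 : ℝ) 1) (h0 : 0 ≤ y)
    (h1 : y ≤ (2 ^ n)⁻¹) : dist (((j : ℝ) + s) / 2 ^ n, y) ((j : ℝ) / 2 ^ n, 0) ≤ (2 ^ n)⁻¹ := by
  rw [Prod.dist_eq, Real.dist_eq, Real.dist_eq, sub_zero, abs_of_nonneg h0]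
  refine max_le ?_ h1
  have : ((j : ℝ) + s) / 2 ^ n - j / 2 ^ n = s * (2 ^ n)⁻¹ := by field_simp; ring
  rw [this, abs_of_nonneg (mul_nonneg hs.1 (by positivity))]
  exact mul_le_of_le_one_left (by positivity) hs.2

theorem teethLoop_mem {n j : ℕ} (hj : j < 2 ^ n) (K : ℕ) (s : ℝ) :
    teethLoop n j K s ∈ laterTeeth := by
  have hb : ((j : ℝ) / 2 ^ n, (0 : ℝ)) ∈ laterTeeth := by
    simpa using bone_mem_laterTeeth (dyadic_mem hj (s := 0) (by simp))
  induction K generalizing s with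
  | zero => exact hb
  | succ K ih =>
    rw [teethLoop]
    split_ifs with h1 h2
    · have := row_mem_laterTeeth h2.2 (dyadic_mem hj (two_mul_zigzag_mem (2 * s)))
      rw [h2.1] at this
      exact this
    · exact hb
    · exact ih _

theorem dist_teethLoop_le (n j K : ℕ) (s : ℝ) :
    dist (teethLoop n j K s) ((j : ℝ) / 2 ^ n, 0) ≤ (2 ^ n)⁻¹ := by
  induction K generalizing s with
  | zero => simp [teethLoop]
  | succ K ih =>
    rw [teethLoop]
    split_ifs
    · refine dist_dyadic_le (two_mul_zigzag_mem _)
        (mul_nonneg (by positivity) (zigzagScaled_nonneg _ _)) ?_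
      exact (row_height_le _ _ _).trans (zigzagScaled_le _ _)
    · simp
    · exact ih _

theorem approxPath_mem (N : ℕ) {n j : ℕ} (hj : j < 2 ^ n) {s : ℝ} (hs : s ∈ Set.Icc (0 : ℝ) 1) :
    approxPath N n j s ∈ laterTeeth := by
  induction N generalizing n j s with
  | zero => exact bone_mem_laterTeeth (dyadic_mem hj hs)
  | succ N ih =>
    have := hs.2
    rw [approxPath]
    split_ifs with h1 h2
    · exact teethLoop_mem hj _ _
    · exact ih (by rw [pow_succ]; omega) ⟨by linarith, by linarith⟩
    · exact ih (by rw [pow_succ]; omega) ⟨by linarith, by linarith⟩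

theorem dist_two_mul_dyadic (n j : ℕ) :
    dist (((2 * j + 1 : ℕ) : ℝ) / 2 ^ (n + 1), (0 : ℝ)) ((j : ℝ) / 2 ^ n, 0)
      ≤ (2 ^ (n + 1))⁻¹ := by
  have h := dist_dyadic_le (n := n + 1) (j := 2 * j) (s := 1) (y := 0) (by simp) le_rfl
    (by positivity)
  rw [two_mul_dyadic] at h
  exact_mod_cast h

theorem dist_approxPath_le (N n j : ℕ) {s : ℝ} (hs : s ∈ Set.Icc (0 : ℝ) 1) :
    dist (approxPath N n j s) ((j : ℝ) / 2 ^ n, 0) ≤ (2 ^ n)⁻¹ := by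
  induction N generalizing n j s with
  | zero => exact dist_dyadic_le hs le_rfl (by positivity)
  | succ N ih =>
    have := hs.2
    have hn : ((2 : ℝ) ^ n)⁻¹ = (2 ^ (n + 1))⁻¹ + (2 ^ (n + 1))⁻¹ := by
      rw [pow_succ]; field_simp; norm_num
    have hp : (0 : ℝ) < (2 ^ (n + 1))⁻¹ := by positivity
    rw [approxPath]
    split_ifs with h1 h2
    · exact dist_teethLoop_le _ _ _ _
    · have h := ih (n + 1) (2 * j) (s := 4 * s - 2) ⟨by linarith, by linarith⟩
      rw [two_mul_dyadic] at h
      linarith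
    · have h := ih (n + 1) (2 * j + 1) (s := 4 * s - 3) ⟨by linarith, by linarith⟩
      have h' := dist_two_mul_dyadic n j
      rw [hn]
      exact (dist_triangle _ _ _).trans (add_le_add h h')

/-- The two approximations differ only at depth `N`, over dyadic intervals of length `2 ^ (-(n +
N))`, where both stay that close to the left endpoint. The bound has the shape expected by
`cauchySeq_of_le_geometric_two`. -/
theorem dist_approxPath_succ_le (N n j : ℕ) {s : ℝ} (hs : s ∈ Set.Icc (0 : ℝ) 1) :
    dist (approxPath N n j s) (approxPath (N + 1) n j s) ≤ 4 / 2 ^ n / 2 / 2 ^ N := by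
  induction N generalizing n j s with
  | zero =>
    refine (dist_triangle_right _ _ ((j : ℝ) / 2 ^ n, 0)).trans ?_
    refine (add_le_add (dist_approxPath_le 0 n j hs) (dist_approxPath_le 1 n j hs)).trans
      (le_of_eq ?_)
    field_simp
    norm_num
  | succ N ih =>
    have := hs.2
    have e : (4 : ℝ) / 2 ^ n / 2 / 2 ^ (N + 1) = 4 / 2 ^ (n + 1) / 2 / 2 ^ N := by
      rw [pow_succ, pow_succ]; field_simp
    rw [approxPath, approxPath, e]
    split_ifs with h1 h2
    · rw [dist_self]; positivity
    · exact ih _ _ ⟨by linarith, by linarith⟩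
    · exact ih _ _ ⟨by linarith, by linarith⟩

open Filter Topology

/-- The hypothesis sits under the existential so that choosing the limit gives a function on all of
`ℝ`. -/
theorem exists_tendsto_approxPath (n j : ℕ) (s : ℝ) : ∃ x, s ∈ Set.Icc (0 : ℝ) 1 →
    Tendsto (fun N => approxPath N n j s) atTop (𝓝 x) := by
  by_cases hs : s ∈ Set.Icc (0 : ℝ) 1
  · obtain ⟨x, hx⟩ := cauchySeq_tendsto_of_complete
      (cauchySeq_of_le_geometric_two fun N => dist_approxPath_succ_le N n j hs)
    exact ⟨x, fun _ => hx⟩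
  · exact ⟨0, fun h => absurd h hs⟩

/-- A path from `j / 2ⁿ` to `(j + 1) / 2ⁿ` along all teeth of level at least `n`, except those of
the first row. -/
noncomputable def teethPath (n j : ℕ) (s : ℝ) : ℝ × ℝ := (exists_tendsto_approxPath n j s).choose

theorem tendsto_approxPath (n j : ℕ) {s : ℝ} (hs : s ∈ Set.Icc (0 : ℝ) 1) :
    Tendsto (fun N => approxPath N n j s) atTop (𝓝 (teethPath n j s)) :=
  (exists_tendsto_approxPath n j s).choose_spec hs

theorem continuousOn_teethPath (n j : ℕ) : ContinuousOn (teethPath n j) (Set.Icc 0 1) := by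
  have h : TendstoUniformlyOn (fun N => approxPath N n j) (teethPath n j) atTop
      (Set.Icc 0 1) := by
    rw [Metric.tendstoUniformlyOn_iff]
    intro ε hε
    have ht : Tendsto (fun N : ℕ => (4 / 2 ^ n : ℝ) / 2 ^ N) atTop (𝓝 0) :=
      tendsto_const_nhds.div_atTop (tendsto_pow_atTop_atTop_of_one_lt one_lt_two)
    filter_upwards [ht.eventually_lt_const hε] with N hN s hs
    rw [dist_comm]
    exact (dist_le_of_le_geometric_two_of_tendsto (fun N => dist_approxPath_succ_le N n j hs)
      (tendsto_approxPath n j hs) N).trans_lt hN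
  exact h.continuousOn (Frequently.of_forall fun N => (continuous_approxPath N n j).continuousOn)

theorem teethPath_mem {n j : ℕ} (hj : j < 2 ^ n) {s : ℝ} (hs : s ∈ Set.Icc (0 : ℝ) 1) :
    teethPath n j s ∈ laterTeeth :=
  isClosed_laterTeeth.mem_of_tendsto (tendsto_approxPath n j hs)
    (Eventually.of_forall fun N => approxPath_mem N hj hs)

theorem teethPath_zero (n j : ℕ) : teethPath n j 0 = ((j : ℝ) / 2 ^ n, 0) := by
  refine tendsto_nhds_unique (tendsto_approxPath n j (by simp)) ?_
  simp only [(approxPath_zero_one _ n j).1, tendsto_const_nhds]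

theorem teethPath_of_le_half (n j : ℕ) {s : ℝ} (h₀ : 0 ≤ s) (h : s ≤ 1 / 2) :
    teethPath n j s = teethLoop n j (2 ^ 2 ^ (n + 1)) (2 * s) := by
  refine tendsto_nhds_unique ((tendsto_approxPath n j ⟨h₀, by linarith⟩).comp
    (tendsto_add_atTop_nat 1)) ?_
  have : (fun N => approxPath N n j s) ∘ (fun N => N + 1) =
      fun _ => teethLoop n j (2 ^ 2 ^ (n + 1)) (2 * s) := by
    funext N
    simp only [Function.comp, approxPath, if_pos h]
  rw [this]
  exact tendsto_const_nhds

/-- Self-similarity: the third quarter of the path is the path over the left half of the dyadic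
interval, and the last quarter is the one over the right half. -/
theorem image_teethPath_even_subset (n j : ℕ) :
    teethPath (n + 1) (2 * j) '' Set.Icc 0 1 ⊆ teethPath n j '' Set.Icc 0 1 := by
  rintro _ ⟨s, hs, rfl⟩
  have h0 := hs.1
  have h1 := hs.2
  -- At `s = 0` the parameter `(s + 2) / 4` would be `1 / 2`, which belongs to the loop branch; the
  -- common starting point is used instead.
  rcases h0.eq_or_lt with rfl | h0
  · refine ⟨0, by simp, ?_⟩
    rw [teethPath_zero, teethPath_zero, two_mul_dyadic]
  have hs' : (s + 2) / 4 ∈ Set.Icc (0 : ℝ) 1 := ⟨by linarith, by linarith⟩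
  refine ⟨(s + 2) / 4, hs', tendsto_nhds_unique
    ((tendsto_approxPath n j hs').comp (tendsto_add_atTop_nat 1)) ?_⟩
  convert tendsto_approxPath (n + 1) (2 * j) hs using 2 with N
  simp only [Function.comp, approxPath]
  rw [if_neg (by linarith), if_pos (by linarith)]
  congr 1
  ring

theorem image_teethPath_odd_subset (n j : ℕ) :
    teethPath (n + 1) (2 * j + 1) '' Set.Icc 0 1 ⊆ teethPath n j '' Set.Icc 0 1 := by
  rintro _ ⟨s, hs, rfl⟩
  have h0 := hs.1
  have h1 := hs.2
  have hs' : (s + 3) / 4 ∈ Set.Icc (0 : ℝ) 1 := ⟨by linarith, by linarith⟩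
  refine ⟨(s + 3) / 4, hs', tendsto_nhds_unique
    ((tendsto_approxPath n j hs').comp (tendsto_add_atTop_nat 1)) ?_⟩
  convert tendsto_approxPath (n + 1) (2 * j + 1) hs using 2 with N
  simp only [Function.comp, approxPath]
  -- At `s = 0` the parameter is `3 / 4`, which belongs to the left half; its end is the start of
  -- the right half.
  rcases h0.eq_or_lt with rfl | h0
  · rw [if_neg (by norm_num), if_pos (by norm_num), (approxPath_zero_one _ _ _).1]
    norm_num
    rw [(approxPath_zero_one _ _ _).2]
    push_cast
    rfl
  · rw [if_neg (by linarith), if_neg (by linarith)]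
    congr 1
    ring

theorem image_teethPath_subset {n j : ℕ} (hj : j < 2 ^ n) :
    teethPath n j '' Set.Icc 0 1 ⊆ teethPath 0 0 '' Set.Icc 0 1 := by
  induction n generalizing j with
  | zero =>
    obtain rfl : j = 0 := by simpa using hj
    exact subset_rfl
  | succ n ih =>
    rw [pow_succ] at hj
    rcases Nat.even_or_odd' j with ⟨i, rfl | rfl⟩
    · exact (image_teethPath_even_subset n i).trans (ih (by omega))
    · exact (image_teethPath_odd_subset n i).trans (ih (by omega))

theorem exists_teethLoop_eq {n j k K : ℕ} (hk : loglogSeq k = n) (h2 : 2 ≤ k) (hkK : k < K)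
    {t : ℝ} (ht : t ∈ Set.Icc (0 : ℝ) 1) :
    ∃ s ∈ Set.Icc (0 : ℝ) 1, teethLoop n j K s =
      ((j + t) / 2 ^ n, 1 / (k : ℝ) * zigzagScaled n ((j + t) / 2 ^ n)) := by
  induction K with
  | zero => omega
  | succ K ih =>
    rcases (Nat.lt_succ_iff.1 hkK).eq_or_lt with rfl | hlt
    · have h0 := ht.1
      have h1 := ht.2
      -- The outward half of `toothLoop` already covers the tooth, and it occupies the first quarter
      -- of the parameter interval.
      refine ⟨t / 4, ⟨by linarith, by linarith⟩, ?_⟩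
      have hz : 2 * zigzag (2 * (t / 4)) = t := by
        rw [zigzag_of_mem_right _ 0 (by push_cast; linarith) (by push_cast; linarith)]
        push_cast
        ring
      rw [teethLoop, if_pos (by linarith), if_pos ⟨hk, h2⟩, toothLoop, hz]
    · obtain ⟨s, hs, he⟩ := ih hlt
      rcases hs.1.eq_or_lt with rfl | h0
      · refine ⟨1, by simp, ?_⟩
        rw [(teethLoop_zero_one _ _ _).2, ← he, (teethLoop_zero_one _ _ _).1]
      · refine ⟨(s + 1) / 2, ⟨by linarith, by linarith [hs.2]⟩, ?_⟩
        rw [teethLoop, if_neg (by linarith), ← he]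
        congr 1
        ring

theorem exists_dyadic_eq (n : ℕ) {t : ℝ} (ht : t ∈ Set.Icc (0 : ℝ) 1) :
    ∃ j < 2 ^ n, ∃ s ∈ Set.Icc (0 : ℝ) 1, t = ((j : ℕ) + s) / 2 ^ n := by
  have h2 : (0 : ℝ) < 2 ^ n := by positivity
  rcases ht.2.eq_or_lt with rfl | h1
  · refine ⟨2 ^ n - 1, Nat.sub_lt (by positivity) one_pos, 1, by simp, ?_⟩
    rw [Nat.cast_sub Nat.one_le_two_pow]
    push_cast
    field_simp
    ring
  · have h0 : 0 ≤ 2 ^ n * t := mul_nonneg h2.le ht.1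
    have hf := Nat.floor_le h0
    have hf' := Nat.lt_floor_add_one (2 ^ n * t)
    refine ⟨⌊2 ^ n * t⌋₊, ?_, 2 ^ n * t - ⌊2 ^ n * t⌋₊, ⟨by linarith, by linarith⟩, ?_⟩
    · rw [Nat.floor_lt h0]
      push_cast
      nlinarith
    · field_simp
      ring

theorem row_mem_image_teethPath {k : ℕ} (hk : 2 ≤ k) {t : ℝ} (ht : t ∈ Set.Icc (0 : ℝ) 1) :
    (t, 1 / (k : ℝ) * zigzagScaled (loglogSeq k) t) ∈ teethPath 0 0 '' Set.Icc 0 1 := by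
  obtain ⟨j, hj, s, hs, rfl⟩ := exists_dyadic_eq (loglogSeq k) ht
  obtain ⟨r, hr, he⟩ := exists_teethLoop_eq (j := j) rfl hk (lt_of_loglogSeq_eq rfl) hs
  have h0 := hr.1
  have h1 := hr.2
  refine image_teethPath_subset hj ⟨r / 2, ⟨by linarith, by linarith⟩, ?_⟩
  rw [teethPath_of_le_half _ _ (by linarith) (by linarith), ← he]
  congr 1
  ring

/-- The rows lie in the compact image of the path, and their heights over a fixed `t` tend to `0`.
-/
theorem bone_mem_image_teethPath {t : ℝ} (ht : t ∈ Set.Icc (0 : ℝ) 1) :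
    (t, (0 : ℝ)) ∈ teethPath 0 0 '' Set.Icc 0 1 := by
  have hc : IsClosed (teethPath 0 0 '' Set.Icc 0 1) :=
    (isCompact_Icc.image_of_continuousOn (continuousOn_teethPath 0 0)).isClosed
  have ht' : Tendsto (fun k : ℕ => (t, 1 / (k : ℝ) * zigzagScaled (loglogSeq k) t)) atTop
      (𝓝 (t, 0)) := by
    refine tendsto_const_nhds.prodMk_nhds ?_
    refine squeeze_zero (fun k => mul_nonneg (by positivity) (zigzagScaled_nonneg _ _))
      (fun k => mul_le_of_le_one_right (by positivity) ((zigzagScaled_le _ _).trans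
        (inv_le_one_of_one_le₀ (one_le_pow₀ (by norm_num))))) tendsto_one_div_atTop_nhds_zero_nat
  refine hc.mem_of_tendsto ht' ?_
  filter_upwards [eventually_ge_atTop 2] with k hk
  exact row_mem_image_teethPath hk ht

theorem loglogSeq_one : loglogSeq 1 = 0 := loglogSeq_eq (by norm_num) (by norm_num)

theorem sharkTeeth_height_le {p : ℝ × ℝ} (hp : p ∈ sharkTeeth loglogSeq) : p.2 ≤ zigzag p.1 := by
  obtain ⟨-, h | ⟨k, -, h⟩⟩ := mem_sharkTeeth.1 hp
  · rw [h]
    exact zigzag_nonneg _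
  · rw [h, ← zigzagScaled_zero]
    exact (row_height_le _ _ _).trans (zigzagScaled_antitone _ (Nat.zero_le _))

/-! ### The five maps. -/

open unitInterval

/-- A map of the shark teeth to the unit interval that vanishes outside the first row. -/
noncomputable def firstRowMap : C(sharkTeeth loglogSeq, I) where
  -- On the first row the height is `zigzag`, giving `2 * zigzag`, with range `[0, 1]`; on all other
  -- rows it is at most half of `zigzag`, so the maximum is `0`.
  toFun p := ⟨max 0 (4 * (p : ℝ × ℝ).2 - 2 * zigzag (p : ℝ × ℝ).1), le_max_left _ _, by
    have h1 := sharkTeeth_height_le p.2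
    have h2 := zigzag_le_half (p : ℝ × ℝ).1
    exact max_le zero_le_one (by linarith)⟩
  continuous_toFun := by
    have h := continuous_zigzag
    refine Continuous.subtype_mk ?_ _
    fun_prop

/-- The path `teethPath 0 0` in the shark teeth. -/
noncomputable def laterRowsPath : C(I, sharkTeeth loglogSeq) where
  toFun s := ⟨teethPath 0 0 s, (teethPath_mem (by norm_num) s.2).1⟩
  continuous_toFun :=
    Continuous.subtype_mk (continuousOn_iff_continuous_domRestrict.1 (continuousOn_teethPath 0 0)) _

/-- The `i`-th quarter of the first row. -/
noncomputable def firstRowArc (i : Fin 4) : C(I, sharkTeeth loglogSeq) where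
  toFun s := ⟨(((i : ℕ) + s) / 2 ^ 2, zigzag (((i : ℕ) + s) / 2 ^ 2)), by
    have h := row_mem_sharkTeeth loglogSeq le_rfl (dyadic_mem (n := 2) (j := i) i.2 s.2)
    rw [loglogSeq_one, zigzagScaled_zero] at h
    simpa using h⟩
  continuous_toFun := by
    have h := continuous_zigzag
    refine Continuous.subtype_mk ?_ _
    fun_prop

theorem firstRowMap_laterRowsPath (s : I) : firstRowMap (laterRowsPath s) = 0 := by
  have h := (teethPath_mem (n := 0) (j := 0) (by norm_num) s.2).2
  refine Subtype.ext (max_eq_left ?_)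
  change 4 * (teethPath 0 0 s).2 - 2 * zigzag (teethPath 0 0 s).1 ≤ 0
  linarith

/-- The reason for cutting the first row into quarters: the slope is `2 / 4 = 1 / 2`. -/
theorem firstRowMap_firstRowArc (i : Fin 4) (s : I) :
    (firstRowMap (firstRowArc i s) : ℝ) = 2 * zigzag (((i : ℕ) + s) / 2 ^ 2) := by
  have h := zigzag_nonneg (((i : ℕ) + (s : ℝ)) / 2 ^ 2)
  change max 0 (4 * zigzag (((i : ℕ) + (s : ℝ)) / 2 ^ 2) -
    2 * zigzag (((i : ℕ) + (s : ℝ)) / 2 ^ 2)) = _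
  rw [max_eq_right (by linarith)]
  ring

/-- Surjectivity ensures that precomposing a path with `firstRowMap` loses no point of its image. -/
theorem exists_firstRowMap_eq (s : I) : ∃ p, firstRowMap p = s := by
  have h0 := s.2.1
  have h1 := s.2.2
  have ht : (s : ℝ) / 2 ∈ Set.Icc (0 : ℝ) 1 := ⟨by linarith, by linarith⟩
  have h := row_mem_sharkTeeth loglogSeq le_rfl ht
  have hz : zigzag ((s : ℝ) / 2) = s / 2 := by
    rw [zigzag_of_mem_right _ 0 (by push_cast; linarith) (by push_cast; linarith)]
    simp
  rw [loglogSeq_one, zigzagScaled_zero, hz] at h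
  refine ⟨⟨_, h⟩, Subtype.ext ?_⟩
  change max 0 (4 * (1 / ((1 : ℕ) : ℝ) * ((s : ℝ) / 2)) - 2 * zigzag ((s : ℝ) / 2)) = s
  rw [hz, max_eq_right (by push_cast; linarith)]
  push_cast
  ring

theorem isTopologicalIFSAttractor_sharkTeeth :
    IsTopologicalIFSAttractor (sharkTeeth loglogSeq) := by
  have : CompactSpace (sharkTeeth loglogSeq) :=
    isCompact_iff_compactSpace.1 (isCompact_sharkTeeth _)
  have : Nonempty (sharkTeeth loglogSeq) := ⟨⟨_, bone_mem_sharkTeeth _ (t := 0) (by simp)⟩⟩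
  refine isTopologicalIFSAttractor_of_factor_unitInterval (n := 5)
    (Fin.cons laterRowsPath firstRowArc) firstRowMap ?_ ?_
  · rintro ⟨⟨t, y⟩, hp⟩
    have hsurj : ∀ (i : Fin 5) (s : I),
        (Fin.cons laterRowsPath firstRowArc : Fin 5 → C(I, sharkTeeth loglogSeq)) i s
          = ⟨(t, y), hp⟩ → ∃ i y', (Fin.cons laterRowsPath firstRowArc :
            Fin 5 → C(I, sharkTeeth loglogSeq)) i (firstRowMap y') = ⟨(t, y), hp⟩ := by
      intro i s h
      obtain ⟨q, rfl⟩ := exists_firstRowMap_eq s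
      exact ⟨i, q, h⟩
    have hlater : (t, y) ∈ teethPath 0 0 '' Set.Icc 0 1 → ∃ i y', (Fin.cons laterRowsPath
        firstRowArc : Fin 5 → C(I, sharkTeeth loglogSeq)) i (firstRowMap y') = ⟨(t, y), hp⟩ := by
      rintro ⟨s, hs, he⟩
      exact hsurj 0 ⟨s, hs⟩ (Subtype.ext he)
    obtain ⟨ht, hy⟩ := mem_sharkTeeth.1 hp
    simp only at ht hy
    rcases hy with rfl | ⟨k, hk, rfl⟩
    · exact hlater (bone_mem_image_teethPath ht)
    rcases hk.eq_or_lt with rfl | hk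
    · obtain ⟨j, hj, s, hs, rfl⟩ := exists_dyadic_eq 2 ht
      refine hsurj (Fin.succ ⟨j, hj⟩) ⟨s, hs⟩ (Subtype.ext (Prod.ext rfl ?_))
      change zigzag _ = _
      simp [loglogSeq_one, zigzagScaled_zero]
    · exact hlater (row_mem_image_teethPath hk ht)
  · intro i s t
    refine Fin.cases ?_ (fun i => ?_) i
    · simp only [Fin.cons_zero, firstRowMap_laterRowsPath, dist_self]
      positivity
    · simp only [Fin.cons_succ]
      rw [Subtype.dist_eq, firstRowMap_firstRowArc, firstRowMap_firstRowArc, Subtype.dist_eq,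
        Real.dist_eq, Real.dist_eq, ← mul_sub, abs_mul, abs_of_pos (two_pos : (0 : ℝ) < 2)]
      have h := abs_zigzag_sub_le (((i : ℕ) + (s : ℝ)) / 2 ^ 2) (((i : ℕ) + (t : ℝ)) / 2 ^ 2)
      have e : ((i : ℕ) + (s : ℝ)) / 2 ^ 2 - ((i : ℕ) + (t : ℝ)) / 2 ^ 2 = (s - t) / 4 := by ring
      rw [e, abs_div, abs_of_pos (by norm_num : (0 : ℝ) < 4)] at h
      linarith

/-! ### Isolating a single tooth. -/

/-- The tooth of the `k`-th row, of level `n`, over `(j / 2ⁿ, (j + 1) / 2ⁿ)` as the intersection of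
the shark teeth with an open set. -/
def openTooth (n j k : ℕ) : Set (ℝ × ℝ) :=
  {p | (j : ℝ) / 2 ^ n < p.1 ∧ p.1 < ((j + 1 : ℕ) : ℝ) / 2 ^ n ∧
    ((k : ℝ) - 1) * p.2 < zigzagScaled n p.1 ∧ zigzagScaled n p.1 < ((k : ℝ) + 1) * p.2}

theorem isOpen_openTooth (n j k : ℕ) : IsOpen (openTooth n j k) := by
  have h := (continuous_zigzagScaled n).comp (continuous_fst (X := ℝ) (Y := ℝ))
  refine (isOpen_lt continuous_const continuous_fst).inter
    ((isOpen_lt continuous_fst continuous_const).inter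
      ((isOpen_lt (by fun_prop) h).inter (isOpen_lt h (by fun_prop))))

theorem row_mem_openTooth {n j k : ℕ} (hk : 1 ≤ k) {t : ℝ} (h₁ : (j : ℝ) / 2 ^ n < t)
    (h₂ : t < ((j + 1 : ℕ) : ℝ) / 2 ^ n) : (t, 1 / (k : ℝ) * zigzagScaled n t) ∈ openTooth n j k := by
  have hz := zigzagScaled_pos h₁ h₂
  have hk' : (0 : ℝ) < k := by exact_mod_cast hk
  have hy : 0 < 1 / (k : ℝ) * zigzagScaled n t := by positivity
  have e : (k : ℝ) * (1 / (k : ℝ) * zigzagScaled n t) = zigzagScaled n t := by field_simp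
  refine ⟨h₁, h₂, ?_, ?_⟩ <;> simp only <;> nlinarith

/-- A point of row `l` satisfies `l * p.2 = zigzagScaled (loglogSeq l) p.1`. For `l > k` this is at
most `zigzagScaled n p.1`, and for `l < k` at least that, so one of the two strict inequalities of
`openTooth` fails. -/
theorem eq_row_of_mem_openTooth {n j k : ℕ} (hk : 1 ≤ k) (hn : loglogSeq k = n) {p : ℝ × ℝ}
    (hp : p ∈ sharkTeeth loglogSeq) (h : p ∈ openTooth n j k) :
    p.2 = 1 / (k : ℝ) * zigzagScaled n p.1 := by
  obtain ⟨h1, h2, h3, h4⟩ := h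
  have hz := zigzagScaled_pos h1 h2
  obtain ⟨-, hy | ⟨l, hl, hy⟩⟩ := mem_sharkTeeth.1 hp
  · rw [hy] at h4
    linarith
  have hl' : (0 : ℝ) < l := by exact_mod_cast hl
  have hly : (l : ℝ) * p.2 = zigzagScaled (loglogSeq l) p.1 := by rw [hy]; field_simp
  have hy0 : 0 ≤ p.2 := by
    rw [hy]
    exact mul_nonneg (by positivity) (zigzagScaled_nonneg _ _)
  rcases lt_trichotomy k l with hkl | rfl | hkl
  · have hm := zigzagScaled_antitone p.1 (loglogSeq_mono hk hkl.le)
    have hkl' : (k : ℝ) + 1 ≤ l := by exact_mod_cast hkl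
    simp only [hn] at hm
    nlinarith
  · rw [← hn]
    exact hy
  · have hm := zigzagScaled_antitone p.1 (loglogSeq_mono hl hkl.le)
    have hkl' : (l : ℝ) + 1 ≤ k := by exact_mod_cast hkl
    simp only [hn] at hm
    nlinarith

/-- The open tooth is relatively open, and adding its two ends makes it closed; hence it is clopen
in the shark teeth without these ends. -/
theorem preconnected_subset_openTooth {n j k : ℕ} (hk : 1 ≤ k) (hn : loglogSeq k = n)
    {S : Set (sharkTeeth loglogSeq)} (hS : IsPreconnected S)
    (hl : ∀ p ∈ S, (p : ℝ × ℝ) ≠ ((j : ℝ) / 2 ^ n, 0))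
    (hr : ∀ p ∈ S, (p : ℝ × ℝ) ≠ (((j + 1 : ℕ) : ℝ) / 2 ^ n, 0))
    (hne : ∃ p ∈ S, (p : ℝ × ℝ) ∈ openTooth n j k) :
    ∀ p ∈ S, (p : ℝ × ℝ) ∈ openTooth n j k := by
  have hT : IsClosed {p : ℝ × ℝ | (j : ℝ) / 2 ^ n ≤ p.1 ∧ p.1 ≤ ((j + 1 : ℕ) : ℝ) / 2 ^ n ∧
      p.2 = 1 / (k : ℝ) * zigzagScaled n p.1} := by
    have h := (continuous_zigzagScaled n).comp (continuous_fst (X := ℝ) (Y := ℝ))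
    exact (isClosed_le continuous_const continuous_fst).inter
      ((isClosed_le continuous_fst continuous_const).inter
        (isClosed_eq continuous_snd (continuous_const.mul h)))
  refine hS.subset_left_of_subset_union (u := Subtype.val ⁻¹' openTooth n j k)
    ((isOpen_openTooth n j k).preimage continuous_subtype_val)
    (hT.isOpen_compl.preimage continuous_subtype_val) ?_ ?_ hne
  · rw [Set.disjoint_left]
    intro p hp hp'
    exact hp' ⟨hp.1.le, hp.2.1.le, eq_row_of_mem_openTooth hk hn p.2 hp⟩
  · intro p hp
    by_cases h : (p : ℝ × ℝ) ∈ {p : ℝ × ℝ | (j : ℝ) / 2 ^ n ≤ p.1 ∧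
        p.1 ≤ ((j + 1 : ℕ) : ℝ) / 2 ^ n ∧ p.2 = 1 / (k : ℝ) * zigzagScaled n p.1}
    · left
      obtain ⟨h1, h2, h3⟩ := h
      have h1' : (j : ℝ) / 2 ^ n ≠ (p : ℝ × ℝ).1 := by
        intro e
        refine hl p hp (Prod.ext e.symm ?_)
        rw [h3, ← e, zigzagScaled_div, mul_zero]
      have h2' : (p : ℝ × ℝ).1 ≠ ((j + 1 : ℕ) : ℝ) / 2 ^ n := by
        intro e
        refine hr p hp (Prod.ext e ?_)
        rw [h3, e, zigzagScaled_div, mul_zero]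
      have := row_mem_openTooth hk (h1.lt_of_ne h1') (h2.lt_of_ne h2')
      rw [← h3] at this
      exact this
    · exact Or.inr h

/-! ### Counting teeth against small connected pieces. -/

/-- A connected attractor of `N` contractions with a common constant `K` is covered by `N ^ m`
connected sets of diameter at most `K ^ m` times its own. -/
theorem exists_preconnected_cover {Y : Type*} [MetricSpace Y] [PreconnectedSpace Y] {N : ℕ}
    {f : Fin N → Y → Y} {K : NNReal} (hf : ∀ i, LipschitzWith K (f i))
    (hcov : (⋃ i, Set.range (f i)) = Set.univ) {D : ℝ} (hD : ∀ x y : Y, dist x y ≤ D) (m : ℕ) :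
    ∃ F : (Fin m → Fin N) → Set Y, (∀ w, IsPreconnected (F w)) ∧
      (∀ w, ∀ x ∈ F w, ∀ y ∈ F w, dist x y ≤ K ^ m * D) ∧ ∀ x, ∃ w, x ∈ F w := by
  induction m with
  | zero =>
    refine ⟨fun _ => Set.univ, fun _ => isPreconnected_univ, fun _ x _ y _ => ?_,
      fun x => ⟨Fin.elim0, trivial⟩⟩
    simpa using hD x y
  | succ m ih =>
    obtain ⟨F, h1, h2, h3⟩ := ih
    refine ⟨fun w => f (w 0) '' F (Fin.tail w),
      fun w => (h1 _).image _ (hf _).continuous.continuousOn, ?_, fun x => ?_⟩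
    · rintro w _ ⟨x, hx, rfl⟩ _ ⟨y, hy, rfl⟩
      rw [pow_succ', mul_assoc]
      exact ((hf _).dist_le_mul x y).trans
        (mul_le_mul_of_nonneg_left (h2 _ x hx y hy) K.coe_nonneg)
    · obtain ⟨i, y, rfl⟩ := Set.mem_iUnion.1 (hcov.symm ▸ Set.mem_univ x)
      obtain ⟨w, hw⟩ := h3 y
      exact ⟨Fin.cons i w, y, by simpa using hw, by simp⟩

/-- Triangle inequality along the chain: not every step can be shorter than the average. -/
theorem exists_dyadic_dist_ge {Y : Type*} [MetricSpace Y] (g : ℕ → Y) (n : ℕ) :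
    ∃ j < 2 ^ n, dist (g 0) (g (2 ^ n)) / 2 ^ n ≤ dist (g j) (g (j + 1)) := by
  by_contra! h
  have h1 := dist_le_range_sum_dist g (2 ^ n)
  have h2 : ∑ i ∈ Finset.range (2 ^ n), dist (g i) (g (i + 1)) <
      ∑ _i ∈ Finset.range (2 ^ n), dist (g 0) (g (2 ^ n)) / 2 ^ n :=
    Finset.sum_lt_sum_of_nonempty (by simp) fun i hi => h i (Finset.mem_range.1 hi)
  rw [Finset.sum_const, Finset.card_range, nsmul_eq_mul] at h2
  push_cast at h2
  rw [mul_div_cancel₀ _ (by positivity)] at h2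
  linarith

/-- On any tooth there is a point that is far from both ends of the tooth in a given metric. -/
theorem exists_mem_openTooth_dist_ge {Y : Type*} [MetricSpace Y] {h : sharkTeeth loglogSeq → Y}
    (hc : Continuous h) {n j k : ℕ} (hk : 1 ≤ k) (hn : loglogSeq k = n)
    {p q : sharkTeeth loglogSeq} (hp : (p : ℝ × ℝ) = ((j : ℝ) / 2 ^ n, 0))
    (hq : (q : ℝ × ℝ) = (((j + 1 : ℕ) : ℝ) / 2 ^ n, 0)) (hpq : h p ≠ h q) :
    ∃ x : sharkTeeth loglogSeq, (x : ℝ × ℝ) ∈ openTooth n j k ∧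
      dist (h p) (h q) / 2 ≤ dist (h x) (h p) ∧ dist (h p) (h q) / 2 ≤ dist (h x) (h q) := by
  have hpm : (j : ℝ) / 2 ^ n ∈ Set.Icc (0 : ℝ) 1 := by
    have := (mem_sharkTeeth.1 p.2).1
    rwa [hp] at this
  have hqm : ((j + 1 : ℕ) : ℝ) / 2 ^ n ∈ Set.Icc (0 : ℝ) 1 := by
    have := (mem_sharkTeeth.1 q.2).1
    rwa [hq] at this
  have hle : (j : ℝ) / 2 ^ n ≤ ((j + 1 : ℕ) : ℝ) / 2 ^ n := by
    gcongr
    omega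
  have hm : ∀ t : Set.Icc (0 : ℝ) 1,
      ((t : ℝ), 1 / (k : ℝ) * zigzagScaled n t) ∈ sharkTeeth loglogSeq := fun t =>
    hn ▸ row_mem_sharkTeeth loglogSeq hk t.2
  let r : ℝ → sharkTeeth loglogSeq := fun t => ⟨_, hm (Set.projIcc 0 1 zero_le_one t)⟩
  have hr : Continuous r := by
    have := continuous_zigzagScaled n
    refine Continuous.subtype_mk ?_ _
    fun_prop
  have hrv : ∀ t ∈ Set.Icc (0 : ℝ) 1, (r t : ℝ × ℝ) = (t, 1 / (k : ℝ) * zigzagScaled n t) := by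
    intro t ht
    simp only [r, Set.projIcc_of_mem zero_le_one ht]
  have hrp : r (j / 2 ^ n) = p := Subtype.ext (by
    rw [hp, hrv _ hpm, zigzagScaled_div, mul_zero])
  have hrq : r (((j + 1 : ℕ) : ℝ) / 2 ^ n) = q := Subtype.ext (by
    rw [hq, hrv _ hqm, zigzagScaled_div, mul_zero])
  have hd : 0 < dist (h p) (h q) := dist_pos.2 hpq
  -- A zero of this function is equidistant from both ends, hence at least half their distance from
  -- each.
  have hφ : Continuous fun t => dist (h (r t)) (h p) - dist (h (r t)) (h q) := by fun_prop
  obtain ⟨t, ht, h0⟩ := intermediate_value_Icc hle hφ.continuousOn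
    (show (0 : ℝ) ∈ Set.Icc _ _ by
      rw [hrp, hrq, dist_self, dist_self, dist_comm (h q)]
      constructor <;> linarith)
  simp only at h0
  have htri := dist_triangle_left (h p) (h q) (h (r t))
  have h1 : (j : ℝ) / 2 ^ n ≠ t := by
    rintro rfl
    rw [hrp, dist_self] at h0
    linarith
  have h2 : t ≠ ((j + 1 : ℕ) : ℝ) / 2 ^ n := by
    rintro rfl
    rw [hrq, dist_self, dist_comm (h q)] at h0
    linarith
  refine ⟨r t, ?_, by linarith, by linarith⟩
  rw [hrv t ⟨hpm.1.trans ht.1, ht.2.trans hqm.2⟩]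
  exact row_mem_openTooth hk (ht.1.lt_of_ne h1) (ht.2.lt_of_ne h2)

/-- Polynomial growth with respect to the scale `2⁻ⁿ` is slower than `2 ^ 2 ^ n`. -/
theorem exists_pow_mul_lt_and_pow_lt {K D Δ : ℝ} (N : ℕ) (hK0 : 0 ≤ K) (hK1 : K < 1) (hD : 0 ≤ D)
    (hΔ : 0 < Δ) : ∃ n m : ℕ, K ^ m * D < Δ / 2 ^ n / 2 ∧ N ^ m < 2 ^ 2 ^ n := by
  -- `L` contractions halve the scale and `c` further halvings absorb `D` and `Δ`, so `m = L * (n +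
  -- c)` is linear in `n`. The divisor `D + 1` below allows `D = 0`.
  obtain ⟨L, hL⟩ := exists_pow_lt_of_lt_one (by norm_num : (0 : ℝ) < 1 / 2) hK1
  obtain ⟨c, hc⟩ := exists_pow_lt_of_lt_one (by positivity : 0 < Δ / 2 / (D + 1))
    (by norm_num : (1 / 2 : ℝ) < 1)
  rw [lt_div_iff₀ (by positivity)] at hc
  have hcp : (0 : ℝ) < (1 / 2) ^ c := by positivity
  set u := N * L + c
  -- With this `n`, `2 ^ n = 16 * (2 ^ u) ^ 2` beats the bound `u * (3 * u + 4)` on `N * m`.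
  refine ⟨2 * u + 4, L * (2 * u + 4 + c), ?_, ?_⟩
  · generalize 2 * u + 4 = n
    calc K ^ (L * (n + c)) * D ≤ (1 / 2) ^ (n + c) * D := by
          rw [pow_mul]
          gcongr
      _ = (1 / 2) ^ n * ((1 / 2) ^ c * D) := by ring
      _ < (1 / 2) ^ n * (Δ / 2) := by
          gcongr
          linarith
      _ = Δ / 2 ^ n / 2 := by rw [div_pow, one_pow]; ring
  · have hu : u + 1 ≤ 2 ^ u := Nat.lt_two_pow_self
    have h1 : N * (L * (2 * u + 4 + c)) < 2 ^ (2 * u + 4) := by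
      have e : 2 ^ (2 * u + 4) = 16 * (2 ^ u) ^ 2 := by ring
      have h2 : N * L ≤ u := Nat.le_add_right _ _
      have h3 : c ≤ u := Nat.le_add_left _ _
      calc N * (L * (2 * u + 4 + c)) = N * L * (2 * u + 4 + c) := by ring
        _ ≤ u * (2 * u + 4 + u) := by gcongr
        _ < 16 * (u + 1) ^ 2 := by nlinarith
        _ ≤ 16 * (2 ^ u) ^ 2 := by gcongr
        _ = _ := e.symm
    calc N ^ (L * (2 * u + 4 + c)) ≤ (2 ^ N) ^ (L * (2 * u + 4 + c)) :=
          Nat.pow_le_pow_left Nat.lt_two_pow_self.le _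
      _ = 2 ^ (N * (L * (2 * u + 4 + c))) := (pow_mul _ _ _).symm
      _ < _ := Nat.pow_lt_pow_right one_lt_two h1

theorem not_isIFSAttractor_of_homeomorph {Y : Type*} [MetricSpace Y] (hY : IsIFSAttractor Y)
    (h : sharkTeeth loglogSeq ≃ₜ Y) : False := by
  obtain ⟨hYc, N, f, hf, hcov⟩ := hY
  have hYp : PreconnectedSpace Y := by
    have : PreconnectedSpace (sharkTeeth loglogSeq) :=
      Subtype.preconnectedSpace (isPreconnected_sharkTeeth _)
    exact h.surjective.denseRange.preconnectedSpace h.continuous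
  obtain ⟨K, hK1, hK⟩ : ∃ K : NNReal, K < 1 ∧ ∀ i, LipschitzWith K (f i) := by
    choose K hK using hf
    refine ⟨Finset.univ.sup K, (Finset.sup_lt_iff (by simp)).2 fun i _ => (hK i).1, fun i => ?_⟩
    exact (hK i).2.weaken (Finset.le_sup (Finset.mem_univ i))
  obtain ⟨D, hD⟩ : ∃ D : ℝ, ∀ x y : Y, dist x y ≤ D := by
    obtain ⟨D, hD⟩ := Metric.isBounded_iff.1 (isCompact_univ (X := Y)).isBounded
    exact ⟨D, fun x y => hD trivial trivial⟩
  have hbone : ∀ t : ℝ, ∃ x : sharkTeeth loglogSeq, t ∈ Set.Icc (0 : ℝ) 1 → (x : ℝ × ℝ) = (t, 0) := by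
    intro t
    by_cases ht : t ∈ Set.Icc (0 : ℝ) 1
    · exact ⟨⟨_, bone_mem_sharkTeeth _ ht⟩, fun _ => rfl⟩
    · exact ⟨⟨_, bone_mem_sharkTeeth _ (t := 0) (by simp)⟩, fun h => absurd h ht⟩
  choose b hb using hbone
  have hΔ : 0 < dist (h (b 0)) (h (b 1)) := by
    refine dist_pos.2 (h.injective.ne fun e => ?_)
    have e' := congrArg (fun x : sharkTeeth loglogSeq => (x : ℝ × ℝ).1) e
    simp only [hb 0 (by simp), hb 1 (by simp)] at e'
    norm_num at e'
  set Δ := dist (h (b 0)) (h (b 1)) with hΔdef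
  obtain ⟨n, m, hKm, hNm⟩ : ∃ n m : ℕ, (K : ℝ) ^ m * D < Δ / 2 ^ n / 2 ∧ N ^ m < 2 ^ 2 ^ n :=
    exists_pow_mul_lt_and_pow_lt N K.coe_nonneg (by exact_mod_cast hK1)
      (dist_nonneg.trans (hD (h (b 0)) (h (b 0)))) hΔ
  obtain ⟨F, hF1, hF2, hF3⟩ := exists_preconnected_cover hK hcov hD m
  obtain ⟨j, hj, hjd⟩ := exists_dyadic_dist_ge (fun i : ℕ => h (b ((i : ℝ) / 2 ^ n))) n
  have e1 : ((2 ^ n : ℕ) : ℝ) / 2 ^ n = 1 := by push_cast; exact div_self (by positivity)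
  have e0 : ((0 : ℕ) : ℝ) / 2 ^ n = 0 := by simp
  simp only [e0, e1, ← hΔdef] at hjd
  have hp := hb ((j : ℝ) / 2 ^ n) (by simpa using dyadic_mem hj (s := 0) (by simp))
  have hq := hb (((j + 1 : ℕ) : ℝ) / 2 ^ n) (by simpa using dyadic_mem hj (s := 1) (by simp))
  set p := b ((j : ℝ) / 2 ^ n)
  set q := b (((j + 1 : ℕ) : ℝ) / 2 ^ n)
  have hpq : h p ≠ h q := dist_pos.1 (lt_of_lt_of_le (by positivity) hjd)
  have hone : 1 < 2 ^ 2 ^ n := Nat.one_lt_two_pow (by positivity)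
  -- Level `n` starts at row `2 ^ 2 ^ n - 1` and contains at least the next `2 ^ 2 ^ n` rows,
  -- because `2 * 2 ^ 2 ^ n ≤ 2 ^ 2 ^ (n + 1)`.
  have hlev : ∀ i : Fin (2 ^ 2 ^ n), loglogSeq (2 ^ 2 ^ n - 1 + i) = n := by
    intro i
    have hi := i.2
    refine loglogSeq_eq (by omega) ?_
    have h1 : 2 ^ 2 ^ (n + 1) = 2 ^ 2 ^ n * 2 ^ 2 ^ n := by rw [← pow_add, pow_succ 2 n, mul_two]
    have h2 : 2 * 2 ^ 2 ^ n ≤ 2 ^ 2 ^ n * 2 ^ 2 ^ n := Nat.mul_le_mul_right _ hone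
    omega
  have hpt := fun i : Fin (2 ^ 2 ^ n) => exists_mem_openTooth_dist_ge h.continuous
    (k := 2 ^ 2 ^ n - 1 + i) (by omega) (hlev i) hp hq hpq
  choose x hxo hxp hxq using hpt
  choose w hw using fun i => hF3 (h (x i))
  -- The piece through `x i` is too small to reach an end of the tooth, so it stays inside; if it
  -- also contains `x i'`, that point lies on both teeth, which forces `i = i'`.
  have hinj : Function.Injective w := by
    intro i i' hii
    have hpre : IsPreconnected (h ⁻¹' F (w i)) := by
      rw [h.isPreconnected_preimage]
      exact hF1 _
    have hsub := preconnected_subset_openTooth (j := j) (by omega) (hlev i) hpre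
      (fun y hy e => ?_) (fun y hy e => ?_) ⟨x i, hw i, hxo i⟩ (x i') (by
        have := hw i'
        rwa [← hii] at this)
    · have r1 := eq_row_of_mem_openTooth (by omega) (hlev i) (x i').2 hsub
      have r2 := eq_row_of_mem_openTooth (by omega) (hlev i') (x i').2 (hxo i')
      have hz := zigzagScaled_pos hsub.1 hsub.2.1
      rw [r1] at r2
      have r3 := mul_right_cancel₀ hz.ne' r2
      rw [one_div, one_div, inv_inj] at r3
      have r4 : 2 ^ 2 ^ n - 1 + (i : ℕ) = 2 ^ 2 ^ n - 1 + i' := by exact_mod_cast r3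
      exact Fin.ext (by omega)
    · have e' : y = p := Subtype.ext (e.trans hp.symm)
      have h1 := hF2 _ _ (hw i) _ hy
      rw [e'] at h1
      have h2 := hxp i
      linarith
    · have e' : y = q := Subtype.ext (e.trans hq.symm)
      have h1 := hF2 _ _ (hw i) _ hy
      rw [e'] at h1
      have h2 := hxq i
      linarith
  have hcard := Fintype.card_le_of_injective w hinj
  simp only [Fintype.card_fin, Fintype.card_fun] at hcard
  omega

/-- The shark teeth `M` with `n_k = ⌊log₂ log₂ (k + 1)⌋`, a compact subspace of the plane, is a
topological IFS-attractor, but it is not homeomorphic to any IFS-attractor. -/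
theorem mainTheorem3 :
    IsCompact (sharkTeeth loglogSeq) ∧
    IsTopologicalIFSAttractor (sharkTeeth loglogSeq) ∧
    ∀ (Y : Type*) [MetricSpace Y], IsIFSAttractor Y →
      ¬ Nonempty (sharkTeeth loglogSeq ≃ₜ Y) := by
  refine ⟨isCompact_sharkTeeth _, isTopologicalIFSAttractor_sharkTeeth, ?_⟩
  rintro Y _ hY ⟨h⟩
  exact not_isIFSAttractor_of_homeomorph hY h
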